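/- Let $\mathrm{PG}(2,\mathbb{R})$ be the real projective plane. A set $\mathcal S$ of points of $\mathrm{PG}(2,\mathbb R)$ is called a \emph{generalized KM-arc of type $(0,m,t)$}, where $m,t$ are non-negative integers, if it is a non-empty proper subset of the point set and each point $R\in\mathcal S$ is incident with a line meeting $\mathcal S$ in exactly $t$ points, while every other line through $R$ meets $\mathcal S$ in exactly $m$ points. (In a finite projective plane of order $q$ this is equivalent to: $\mathcal S$ has size $q(m-1)+t$ and meets each line in $0$, $m$ or $t$ points.) Then a finite set $\mathcal S$ of points of $\mathrm{PG}(2,\mathbb R)$ is a generalized KM-arc of type $(0,m,t)$ for some $m,t$ if and only if $\mathcal S$ is non-empty and contained in a line. The same holds if generalized KM-arcs of type $(0,m,t)$, $m\ge 1$, are instead defined as the non-empty proper point sets $\mathcal S$ with $|\mathcal S|=q(m-1)+t$ that meet each line in $0$, $m$ or $t$ points, where $q=|\mathbb R|$ and the size is computed in cardinal arithmetic. -/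

import Mathlib

open scoped LinearAlgebra.Projectivization

/-- The points of the projective plane `PG(2,K)`: the one-dimensional subspaces of `K³`. -/
abbrev PG2 (K : Type*) [Field K] : Type _ := ℙ K (Fin 3 → K)

/-- A line of `PG(2,K)`, as a set of points: all points contained in a fixed two-dimensional
linear subspace of `K³`. -/
def IsLine {K : Type*} [Field K] (l : Set (PG2 K)) : Prop :=
  ∃ W : Submodule K (Fin 3 → K), Module.finrank K W = 2 ∧ l = {P | P.submodule ≤ W}

/-- `l` is an `i`-secant of the point set `S`: a line meeting `S` in exactly `i` points. -/
def IsSecant {K : Type*} [Field K] (S : Set (PG2 K)) (i : ℕ) (l : Set (PG2 K)) : Prop :=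
  IsLine l ∧ (S ∩ l).encard = i

/-- Generalized KM-arc of type `(0,m,t)`, pointwise form: a proper non-empty point set `S` such
that every point of `S` is incident with a `t`-secant and all the other lines through that point
are `m`-secants. (In a finite plane of order `q` this is equivalent to `S` having size
`q(m-1)+t` and meeting each line in `0`, `m` or `t` points.) -/
def IsGeneralizedKMArc {K : Type*} [Field K] (S : Set (PG2 K)) (m t : ℕ) : Prop :=
  S.Nonempty ∧ S ≠ Set.univ ∧
    ∀ R ∈ S, ∃ l : Set (PG2 K), R ∈ l ∧ IsSecant S t l ∧
      ∀ l' : Set (PG2 K), IsLine l' → R ∈ l' → l' ≠ l → IsSecant S m l'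

/-- Generalized KM-arc of type `(0,m,t)`, size form: a proper non-empty point set of size
`q(m-1)+t` that meets each line in `0`, `m` or `t` points. Here `q` is the order of the plane,
that is, the cardinality of `K`; the size is computed in cardinal numbers, so that the definition
also makes sense for infinite planes. -/
def IsGeneralizedKMArcBySize {K : Type*} [Field K] (S : Set (PG2 K)) (m t : ℕ) : Prop :=
  S.Nonempty ∧ S ≠ Set.univ ∧
    1 ≤ m ∧ Cardinal.mk S = Cardinal.mk K * ((m - 1 : ℕ) : Cardinal) + (t : Cardinal) ∧
    ∀ l : Set (PG2 K), IsLine l → IsSecant S 0 l ∨ IsSecant S m l ∨ IsSecant S t l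

/-!
Over an infinite field finitely many lines do not cover the plane, so every point `R` of a finite
set `S` lies on many lines that meet `S` only in `R`. In a pointwise arc such a tangent forces
`m = 1`, and then all of `S` lies on the exceptional line through `R`. In the size form, an
infinite order forces `m - 1 = 0`, hence `t = |S|`, and a line joining two points of `S` can only
be a `t`-secant.
-/

section Points

variable {K V : Type*} [DivisionRing K] [AddCommGroup V] [Module K V]

theorem disjoint_submodule_of_ne {P Q : ℙ K V} (h : P ≠ Q) :
    Disjoint P.submodule Q.submodule := by
  have isAtom (X : ℙ K V) : IsAtom X.submodule :=
    Submodule.isAtom_iff_finrank_eq_one.2 X.finrank_submodule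
  exact (isAtom P).disjoint_of_ne (isAtom Q) (Projectivization.submodule_injective.ne h)

theorem finrank_submodule_sup_submodule_of_ne {P Q : ℙ K V} (h : P ≠ Q) :
    Module.finrank K ↥(P.submodule ⊔ Q.submodule) = 2 := by
  have hsum := Submodule.finrank_sup_add_finrank_inf_eq P.submodule Q.submodule
  rwa [(disjoint_submodule_of_ne h).eq_bot, finrank_bot, P.finrank_submodule,
    Q.finrank_submodule] at hsum

theorem submodule_mk_le_iff {v : V} (hv : v ≠ 0) {W : Submodule K V} :
    (Projectivization.mk K v hv).submodule ≤ W ↔ v ∈ W := by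
  rw [Projectivization.submodule_mk, Submodule.span_singleton_le_iff_mem]

theorem exists_forall_not_submodule_le [Infinite K] [Nontrivial V] {s : Set (Submodule K V)}
    (hs : s.Finite) (htop : ⊤ ∉ s) : ∃ P : ℙ K V, ∀ W ∈ s, ¬P.submodule ≤ W := by
  -- Including `⊥` among the subspaces to be avoided makes the vector found nonzero.
  have htop' : ⊤ ∉ (hs.insert ⊥).toFinset := by simpa using htop
  obtain ⟨v, hv⟩ :=
    (Set.ne_univ_iff_exists_notMem _).1 (Subspace.biUnion_ne_univ_of_top_notMem htop')
  have hv' : v ≠ 0 ∧ ∀ W ∈ s, v ∉ W := by simpa using hv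
  exact ⟨Projectivization.mk K v hv'.1,
    fun W hW hle => hv'.2 W hW ((submodule_mk_le_iff hv'.1).1 hle)⟩

end Points

variable {K : Type*} [Field K]

namespace PG2

/-- The line joining the points `P` and `Q`; for `P = Q` it degenerates to the single point `P`. -/
def lineThrough (P Q : PG2 K) : Set (PG2 K) :=
  {X | X.submodule ≤ P.submodule ⊔ Q.submodule}

theorem left_mem_lineThrough (P Q : PG2 K) : P ∈ lineThrough P Q :=
  le_sup_left (a := P.submodule)

theorem right_mem_lineThrough (P Q : PG2 K) : Q ∈ lineThrough P Q :=
  le_sup_right (b := Q.submodule)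

theorem isLine_lineThrough {P Q : PG2 K} (h : P ≠ Q) : IsLine (lineThrough P Q) :=
  ⟨_, finrank_submodule_sup_submodule_of_ne h, rfl⟩

end PG2

open PG2

namespace IsLine

variable {S l l' : Set (PG2 K)}

theorem eq_lineThrough (hl : IsLine l) {P Q : PG2 K} (h : P ≠ Q) (hP : P ∈ l) (hQ : Q ∈ l) :
    l = lineThrough P Q := by
  obtain ⟨W, hW, rfl⟩ := hl
  have hsup : P.submodule ⊔ Q.submodule = W := Submodule.eq_of_le_of_finrank_eq (sup_le hP hQ)
    ((finrank_submodule_sup_submodule_of_ne h).trans hW.symm)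
  rw [lineThrough, hsup]

theorem inter_subsingleton (hl : IsLine l) (hl' : IsLine l') (hne : l ≠ l') :
    (l ∩ l').Subsingleton := by
  intro P hP Q hQ
  by_contra h
  exact hne ((hl.eq_lineThrough h hP.1 hQ.1).trans (hl'.eq_lineThrough h hP.2 hQ.2).symm)

theorem ne_univ (hl : IsLine l) : l ≠ Set.univ := by
  obtain ⟨W, hW, rfl⟩ := hl
  have htop : W < ⊤ := Submodule.lt_top_of_finrank_lt_finrank (by simp [hW])
  obtain ⟨v, -, hvW⟩ := SetLike.exists_of_lt htop
  have hv : v ≠ 0 := fun h => hvW (h ▸ W.zero_mem)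
  exact (Set.ne_univ_iff_exists_notMem _).2
    ⟨Projectivization.mk K v hv, fun hle => hvW ((submodule_mk_le_iff hv).1 hle)⟩

theorem exists_forall_notMem [Infinite K] {L : Set (Set (PG2 K))} (hL : L.Finite)
    (hlines : ∀ l ∈ L, IsLine l) : ∃ P, ∀ l ∈ L, P ∉ l := by
  choose! W hW hlW using hlines
  have htop : ⊤ ∉ W '' L := by
    rintro ⟨l, hl, htop⟩
    exact (Submodule.lt_top_of_finrank_lt_finrank (by simp [hW l hl])).ne htop
  obtain ⟨P, hP⟩ := exists_forall_not_submodule_le (hL.image W) htop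
  refine ⟨P, fun l hl hPl => hP (W l) (Set.mem_image_of_mem W hl) ?_⟩
  rwa [hlW l hl] at hPl

theorem exists_ne_inter_eq_singleton [Infinite K] (hl : IsLine l) (hS : S.Finite) {R : PG2 K}
    (hRS : R ∈ S) (hRl : R ∈ l) : ∃ l', IsLine l' ∧ l' ≠ l ∧ S ∩ l' = {R} := by
  have hlines : ∀ k ∈ insert l (lineThrough R '' (S \ {R})), IsLine k := by
    rintro _ (rfl | ⟨Q, hQ, rfl⟩)
    · exact hl
    · exact isLine_lineThrough (Ne.symm hQ.2)
  obtain ⟨P, hP⟩ := exists_forall_notMem ((hS.sdiff.image _).insert l) hlines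
  have hPl : P ∉ l := hP l (Set.mem_insert _ _)
  have hRP : R ≠ P := fun h => hPl (h ▸ hRl)
  refine ⟨lineThrough R P, isLine_lineThrough hRP,
    fun h => hPl (h ▸ right_mem_lineThrough R P),
    Set.eq_singleton_iff_unique_mem.2 ⟨⟨hRS, left_mem_lineThrough R P⟩, ?_⟩⟩
  rintro Q ⟨hQS, hQ⟩
  by_contra hQR
  have hjoin : lineThrough R P = lineThrough R Q :=
    (isLine_lineThrough hRP).eq_lineThrough (Ne.symm hQR) (left_mem_lineThrough R P) hQ
  exact hP (lineThrough R Q) (.inr ⟨Q, ⟨hQS, hQR⟩, rfl⟩) (hjoin ▸ right_mem_lineThrough R P)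

theorem inter_subsingleton_of_subset (hl : IsLine l) (hSl : S ⊆ l) (hl' : IsLine l')
    (hne : l' ≠ l) : (S ∩ l').Subsingleton :=
  (hl.inter_subsingleton hl' hne.symm).anti (Set.inter_subset_inter_left l' hSl)

theorem ne_univ_of_subset (hl : IsLine l) (hSl : S ⊆ l) : S ≠ Set.univ :=
  fun h => hl.ne_univ (Set.univ_subset_iff.1 (h ▸ hSl))

theorem isSecant_ncard (hl : IsLine l) (hS : S.Finite) (hSl : S ⊆ l) : IsSecant S S.ncard l :=
  ⟨hl, by rw [Set.inter_eq_left.2 hSl, hS.cast_ncard_eq]⟩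

theorem isGeneralizedKMArc_of_subset (hl : IsLine l) (hS : S.Finite) (hne : S.Nonempty)
    (hSl : S ⊆ l) : IsGeneralizedKMArc S 1 S.ncard := by
  refine ⟨hne, hl.ne_univ_of_subset hSl, fun R hR =>
    ⟨l, hSl hR, hl.isSecant_ncard hS hSl, fun l' hl' hRl' hll' => ⟨hl', ?_⟩⟩⟩
  rw [(hl.inter_subsingleton_of_subset hSl hl' hll').eq_singleton_of_mem ⟨hR, hRl'⟩,
    Set.encard_singleton, Nat.cast_one]

theorem isGeneralizedKMArcBySize_of_subset (hl : IsLine l) (hS : S.Finite) (hne : S.Nonempty)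
    (hSl : S ⊆ l) : IsGeneralizedKMArcBySize S 1 S.ncard := by
  refine ⟨hne, hl.ne_univ_of_subset hSl, le_rfl, by simp [Set.cast_ncard hS], fun l' hl' => ?_⟩
  by_cases hll' : l' = l
  · exact .inr (.inr (hll' ▸ hl.isSecant_ncard hS hSl))
  · rcases (hl.inter_subsingleton_of_subset hSl hl' hll').eq_empty_or_singleton with h | ⟨P, h⟩
    · exact .inl ⟨hl', by simp [h]⟩
    · exact .inr (.inl ⟨hl', by simp [h]⟩)

end IsLine

section FiniteArcs

variable [Infinite K] {S : Set (PG2 K)} {m t : ℕ}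

theorem IsGeneralizedKMArc.eq_one (h : IsGeneralizedKMArc S m t) (hS : S.Finite) : m = 1 := by
  obtain ⟨⟨R, hR⟩, -, harc⟩ := h
  obtain ⟨l, hRl, ⟨hl, -⟩, hm⟩ := harc R hR
  obtain ⟨l', hl', hne, htangent⟩ := hl.exists_ne_inter_eq_singleton hS hR hRl
  have hRl' : R ∈ l' := (htangent.ge rfl).2
  have hcard := (hm l' hl' hRl' hne).2
  rw [htangent, Set.encard_singleton] at hcard
  exact_mod_cast hcard.symm

theorem IsGeneralizedKMArc.exists_isLine_subset (h : IsGeneralizedKMArc S m t)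
    (hS : S.Finite) : ∃ l, IsLine l ∧ S ⊆ l := by
  obtain rfl := h.eq_one hS
  obtain ⟨⟨R, hR⟩, -, harc⟩ := h
  obtain ⟨l, hRl, ⟨hl, -⟩, hone⟩ := harc R hR
  refine ⟨l, hl, fun Q hQ => ?_⟩
  by_contra hQl
  have hRQ : R ≠ Q := fun h => hQl (h ▸ hRl)
  have hcard : (S ∩ lineThrough R Q).encard = 1 :=
    (hone _ (isLine_lineThrough hRQ) (left_mem_lineThrough R Q)
      fun h => hQl (h ▸ right_mem_lineThrough R Q)).2
  exact hRQ (Set.encard_le_one_iff_subsingleton.1 hcard.le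
    ⟨hR, left_mem_lineThrough R Q⟩ ⟨hQ, right_mem_lineThrough R Q⟩)

theorem IsGeneralizedKMArcBySize.eq_one (h : IsGeneralizedKMArcBySize S m t) (hS : S.Finite) :
    m = 1 := by
  obtain ⟨-, -, hm, hcard, -⟩ := h
  by_contra hne
  have hpos : ((m - 1 : ℕ) : Cardinal) ≠ 0 := Nat.cast_ne_zero.2 (by lia)
  have hinf : Cardinal.aleph0 ≤ Cardinal.mk S :=
    calc Cardinal.aleph0 ≤ Cardinal.mk K := Cardinal.aleph0_le_mk K
      _ ≤ Cardinal.mk K * (m - 1 : ℕ) := Cardinal.le_mul_right hpos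
      _ ≤ Cardinal.mk K * (m - 1 : ℕ) + t := le_self_add
      _ = Cardinal.mk S := hcard.symm
  exact hinf.not_gt (Cardinal.lt_aleph0_iff_set_finite.2 hS)

theorem IsGeneralizedKMArcBySize.ncard_eq (h : IsGeneralizedKMArcBySize S m t)
    (hS : S.Finite) : S.ncard = t := by
  obtain rfl := h.eq_one hS
  obtain ⟨-, -, -, hcard, -⟩ := h
  rw [← Set.cast_ncard hS, Nat.sub_self, Nat.cast_zero, mul_zero, zero_add] at hcard
  exact_mod_cast hcard

theorem IsGeneralizedKMArcBySize.subset_of_nontrivial_inter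
    (h : IsGeneralizedKMArcBySize S m t) (hS : S.Finite) {l : Set (PG2 K)} (hl : IsLine l)
    (hnontriv : (S ∩ l).Nontrivial) : S ⊆ l := by
  obtain rfl := h.eq_one hS
  obtain rfl := h.ncard_eq hS
  obtain ⟨-, -, -, -, hsec⟩ := h
  have hlt : 1 < (S ∩ l).encard := Set.one_lt_encard_iff_nontrivial.2 hnontriv
  rcases hsec l hl with hzero | hone | hall
  · simp [hzero.2] at hlt
  · simp [hone.2] at hlt
  · have heq : S ∩ l = S := (hS.inter_of_left l).eq_of_subset_of_encard_le Set.inter_subset_left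
      (by rw [hall.2, hS.cast_ncard_eq])
    exact Set.inter_eq_left.1 heq

theorem IsGeneralizedKMArcBySize.exists_isLine_subset (h : IsGeneralizedKMArcBySize S m t)
    (hS : S.Finite) : ∃ l, IsLine l ∧ S ⊆ l := by
  rcases S.subsingleton_or_nontrivial with hsub | ⟨R, hR, Q, hQ, hRQ⟩
  · obtain ⟨⟨R, hR⟩, hproper, -⟩ := h
    obtain ⟨Q, hQ⟩ := (Set.ne_univ_iff_exists_notMem S).1 hproper
    have hRQ : R ≠ Q := fun h => hQ (h ▸ hR)
    exact ⟨lineThrough R Q, isLine_lineThrough hRQ,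
      fun X hX => hsub hR hX ▸ left_mem_lineThrough R Q⟩
  · have hl := isLine_lineThrough hRQ
    exact ⟨lineThrough R Q, hl, h.subset_of_nontrivial_inter hS hl
      ⟨R, ⟨hR, left_mem_lineThrough R Q⟩, Q, ⟨hQ, right_mem_lineThrough R Q⟩, hRQ⟩⟩

end FiniteArcs

theorem corollary6p2_general [Infinite K] (S : Set (PG2 K)) (hS : S.Finite) :
    ((∃ m t : ℕ, IsGeneralizedKMArc S m t) ↔
      S.Nonempty ∧ ∃ l : Set (PG2 K), IsLine l ∧ S ⊆ l) ∧
    ((∃ m t : ℕ, IsGeneralizedKMArcBySize S m t) ↔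
      S.Nonempty ∧ ∃ l : Set (PG2 K), IsLine l ∧ S ⊆ l) := by
  refine ⟨⟨?_, ?_⟩, ⟨?_, ?_⟩⟩
  · rintro ⟨m, t, h⟩
    exact ⟨h.1, h.exists_isLine_subset hS⟩
  · rintro ⟨hne, l, hl, hSl⟩
    exact ⟨1, S.ncard, hl.isGeneralizedKMArc_of_subset hS hne hSl⟩
  · rintro ⟨m, t, h⟩
    exact ⟨h.1, h.exists_isLine_subset hS⟩
  · rintro ⟨hne, l, hl, hSl⟩
    exact ⟨1, S.ncard, hl.isGeneralizedKMArcBySize_of_subset hS hne hSl⟩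

theorem corollary6p2 (S : Set (PG2 ℝ)) (hS : S.Finite) :
    ((∃ m t : ℕ, IsGeneralizedKMArc S m t) ↔
      S.Nonempty ∧ ∃ l : Set (PG2 ℝ), IsLine l ∧ S ⊆ l) ∧
    ((∃ m t : ℕ, IsGeneralizedKMArcBySize S m t) ↔
      S.Nonempty ∧ ∃ l : Set (PG2 ℝ), IsLine l ∧ S ⊆ l) :=
  corollary6p2_general S hS
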